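/- Work over $\mathbb{C}$. Let $V=\bigoplus_{k\in\mathbb{Z}} V_k$ be a vertex operator algebra of CFT type, i.e. $V_k=0$ for $k<0$ and $V_0=\mathbb{C}\mathbf{1}$; put $V_+=\bigoplus_{k\ge 1}V_k$ and write $Y(a,z)=\sum_{m\in\mathbb{Z}}a_m z^{-m-1}$. Let $M=\bigoplus_{n\ge 0}M(n)$ be an admissible $V$-module, i.e. a weak $V$-module with a grading such that $a_mM(n)\subseteq M(n+\mathrm{wt}\,a-m-1)$ for homogeneous $a\in V$ (where $M(p)=0$ for $p<0$). Let $O(M)\subseteq M$ be the linear span of the elements $\mathrm{Res}_z\,Y(a,z)v\,\frac{(1+z)^{\mathrm{wt}\,a}}{z^2}$ with $a\in V$ homogeneous and $v\in M$, let $A(M)=M/O(M)$, and let $O(V)$, $A(V)=V/O(V)$ be the case $M=V$ of this (Zhu's algebra). The left and right actions of $A(V)$ on $A(M)$ are the bilinear maps induced by $$a*v=\mathrm{Res}_z\,Y(a,z)v\,\frac{(1+z)^{\mathrm{wt}\,a}}{z},\qquad v*a=\mathrm{Res}_z\,Y(a,z)v\,\frac{(1+z)^{\mathrm{wt}\,a-1}}{z}$$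 for homogeneous $a\in V$ and $v\in M$. For $n\ge 0$ let $A(V)_n$ be the image of $\bigoplus_{k=0}^nV_k$ in $A(V)$, let $A(M)_n$ be the image of $\bigoplus_{k=0}^nM(k)$ in $A(M)$, and put $A(V)_n=0$ for $n<0$. Suppose that $M$ is strongly generated by finitely many elements $w_1,\dots,w_r$ with $w_i\in M(n_i)$ for all $i$; that is, $M$ is spanned by the elements $a^1_{-m_1}\cdots a^k_{-m_k}w_i$ with $k\ge 0$, $a^1,\dots,a^k\in V_+$ homogeneous, $m_1,\dots,m_k\ge 1$ and $1\le i\le r$. Then for every $n\ge 0$, writing $w_i$ also for the image of $w_i$ in $A(M)$, $$A(M)_n=\sum_{i=1}^rA(V)_{n-n_i}*w_i\qquad\text{and}\qquad A(M)_n=\sum_{i=1}^rw_i*A(V)_{n-n_i}.$$ -/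

import Mathlib

set_option linter.unusedSectionVars false

noncomputable section

namespace VOA

section Modes

variable {V M : Type*} [AddCommGroup V] [Module ℂ V] [AddCommGroup M] [Module ℂ M]

/-- The mode `aₙ` of the field `Y(a, z) = ∑ aₙ z⁻ⁿ⁻¹`. Lower truncation (`aₙ v = 0` for `n` large)
is built into `VertexOperator`. -/
def mode (Y : V →ₗ[ℂ] VertexOperator ℂ M) (a : V) (n : ℤ) : Module.End ℂ M :=
  VertexOperator.ncoeff (Y a) n

/-- The Jacobi identity in components (Borcherds identity). All sums have finite support. -/
def JacobiIdentity (Y : V →ₗ[ℂ] VertexOperator ℂ V) (YM : V →ₗ[ℂ] VertexOperator ℂ M) : Prop :=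
  ∀ (a b : V) (v : M) (m n k : ℤ),
    ∑ᶠ i : ℕ, Ring.choose m i • mode YM (mode Y a (n + i) b) (m + k - i) v =
    ∑ᶠ i : ℕ, ((-1) ^ i * Ring.choose n i) •
      (mode YM a (m + n - i) (mode YM b (k + i) v) -
        (-1 : ℂ) ^ n • mode YM b (n + k - i) (mode YM a (m + i) v))

end Modes

/-- A vertex operator algebra over `ℂ`. -/
structure VertexOperatorAlgebra (V : Type*) [AddCommGroup V] [Module ℂ V] where
  Y : V →ₗ[ℂ] VertexOperator ℂ V
  vacuum : V
  conformal : V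
  centralCharge : ℂ
  /-- The weight spaces `Vₙ`. -/
  wt : ℤ → Submodule ℂ V
  isInternal_wt : DirectSum.IsInternal wt
  finiteDimensional_wt : ∀ n, FiniteDimensional ℂ (wt n)
  wt_eq_bot : ∃ N : ℤ, ∀ n < N, wt n = ⊥
  vacuum_mem : vacuum ∈ wt 0
  conformal_mem : conformal ∈ wt 2
  vacuum_mode : ∀ (n : ℤ) (a : V), mode Y vacuum n a = if n = -1 then a else 0
  mode_neg_one_vacuum : ∀ a : V, mode Y a (-1) vacuum = a
  mode_vacuum : ∀ (a : V) (n : ℤ), 0 ≤ n → mode Y a n vacuum = 0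
  jacobi : JacobiIdentity Y Y
  mode_mem : ∀ (k l n : ℤ) (a b : V), a ∈ wt k → b ∈ wt l → mode Y a n b ∈ wt (k + l - n - 1)
  /-- The operators `L(n) = ω₍ₙ₊₁₎` satisfy the Virasoro relations. -/
  virasoro : ∀ (m n : ℤ) (v : V),
    mode Y conformal (m + 1) (mode Y conformal (n + 1) v) -
      mode Y conformal (n + 1) (mode Y conformal (m + 1) v) =
    ((m : ℂ) - n) • mode Y conformal (m + n + 1) v +
      (if m + n = 0 then ((m : ℂ) ^ 3 - m) / 12 * centralCharge else 0) • v
  L_zero : ∀ (n : ℤ) (a : V), a ∈ wt n → mode Y conformal 1 a = (n : ℂ) • a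
  L_neg_one : ∀ (a : V) (n : ℤ),
    mode Y (mode Y conformal 0 a) n = -(n : ℂ) • mode Y a (n - 1)

/-- CFT type: `V = V₀ ⊕ V₊` with `V₀ = ℂ𝟏` and `V₊ = ⨁_{n ≥ 1} Vₙ`. -/
def VertexOperatorAlgebra.IsCFTType {V : Type*} [AddCommGroup V] [Module ℂ V]
    (A : VertexOperatorAlgebra V) : Prop :=
  (∀ n < 0, A.wt n = ⊥) ∧ A.wt 0 = Submodule.span ℂ {A.vacuum}

/-- A weak module over a vertex operator algebra. -/
structure WeakModule {V : Type*} [AddCommGroup V] [Module ℂ V] (A : VertexOperatorAlgebra V)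
    (M : Type*) [AddCommGroup M] [Module ℂ M] where
  Y : V →ₗ[ℂ] VertexOperator ℂ M
  vacuum_mode : ∀ (n : ℤ) (v : M), mode Y A.vacuum n v = if n = -1 then v else 0
  jacobi : JacobiIdentity A.Y Y

/-- An admissible (that is, `ℕ`-gradable) module `M = ⨁_{n ≥ 0} M(n)`:
`aₘ M(n) ⊆ M(n + wt a - m - 1)`, where `M(p) = 0` for `p < 0`. -/
structure AdmissibleModule {V : Type*} [AddCommGroup V] [Module ℂ V]
    (A : VertexOperatorAlgebra V) (M : Type*) [AddCommGroup M] [Module ℂ M]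
    extends WeakModule A M where
  gr : ℕ → Submodule ℂ M
  isInternal_gr : DirectSum.IsInternal gr
  mode_mem : ∀ (k m : ℤ) (n p : ℕ) (a : V) (v : M), a ∈ A.wt k → v ∈ gr n →
    (p : ℤ) = n + k - m - 1 → mode Y a m v ∈ gr p
  mode_eq_zero : ∀ (k m : ℤ) (n : ℕ) (a : V) (v : M), a ∈ A.wt k → v ∈ gr n →
    (n : ℤ) + k - m - 1 < 0 → mode Y a m v = 0

/-- A vertex operator algebra as a module over itself. -/
def VertexOperatorAlgebra.adjoint {V : Type*} [AddCommGroup V] [Module ℂ V]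
    (A : VertexOperatorAlgebra V) : WeakModule A V where
  Y := A.Y
  vacuum_mode := A.vacuum_mode
  jacobi := A.jacobi

section Residues

variable {V M : Type*} [AddCommGroup V] [Module ℂ V] [AddCommGroup M] [Module ℂ M]

theorem mode_add (Y : V →ₗ[ℂ] VertexOperator ℂ M) (a b : V) (n : ℤ) (v : M) :
    mode Y (a + b) n v = mode Y a n v + mode Y b n v := by
  simp [mode]

theorem mode_smul (Y : V →ₗ[ℂ] VertexOperator ℂ M) (c : ℂ) (a : V) (n : ℤ) (v : M) :
    mode Y (c • a) n v = c • mode Y a n v := by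
  simp [mode]

theorem mode_zero (Y : V →ₗ[ℂ] VertexOperator ℂ M) (n : ℤ) (v : M) :
    mode Y 0 n v = 0 := by
  simp [mode]

theorem exists_mode_eq_zero (Y : V →ₗ[ℂ] VertexOperator ℂ M) (a : V) (v : M) :
    ∃ N : ℤ, ∀ n, N ≤ n → mode Y a n v = 0 :=
  ⟨-HahnSeries.order ((HahnModule.of ℂ).symm (Y a v)), fun n hn =>
    VertexOperator.ncoeff_eq_zero_of_lt_order _ _ _ (by omega)⟩

theorem finsum_eq_sum_range {f : ℕ → M} (N : ℕ) (h : ∀ j, N ≤ j → f j = 0) :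
    ∑ᶠ j, f j = ∑ j ∈ Finset.range N, f j := by
  refine finsum_eq_sum_of_support_subset _ fun j hj => ?_
  by_contra hc
  exact hj (h j (by simpa using hc))

theorem residue_finite (Y : V →ₗ[ℂ] VertexOperator ℂ M) (s p : ℤ) (a : V) (v : M) :
    (Function.support fun j : ℕ => Ring.choose s j • mode Y a (p + j) v).Finite := by
  obtain ⟨N, hN⟩ := exists_mode_eq_zero Y a v
  refine (Finset.range (N - p).toNat).finite_toSet.subset fun j hj => ?_
  by_contra hc
  refine hj ?_
  have : N ≤ p + j := by simp at hc; omega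
  simp [hN _ this]

/-- `residue Y s p a v = Res_z Y(a, z) v (1 + z)ˢ zᵖ = ∑_{j ≥ 0} (s choose j) a₍ₚ₊ⱼ₎ v`. -/
def residue (Y : V →ₗ[ℂ] VertexOperator ℂ M) (s p : ℤ) : V →ₗ[ℂ] M →ₗ[ℂ] M :=
  LinearMap.mk₂ ℂ (fun a v => ∑ᶠ j : ℕ, Ring.choose s j • mode Y a (p + j) v)
    (fun a b v => by
      simp only [mode_add, smul_add]
      exact finsum_add_distrib (residue_finite Y s p a v) (residue_finite Y s p b v))
    (fun c a v => by
      rw [smul_finsum' c (residue_finite Y s p a v)]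
      simp only [mode_smul, smul_comm c])
    (fun a v w => by
      simp only [map_add, smul_add]
      exact finsum_add_distrib (residue_finite Y s p a v) (residue_finite Y s p a w))
    (fun c a v => by
      rw [smul_finsum' c (residue_finite Y s p a v)]
      simp only [map_smul, smul_comm c])

theorem residue_apply (Y : V →ₗ[ℂ] VertexOperator ℂ M) (s p : ℤ) (a : V) (v : M) :
    residue Y s p a v = ∑ᶠ j : ℕ, Ring.choose s j • mode Y a (p + j) v := rfl

theorem residue_eq_sum (Y : V →ₗ[ℂ] VertexOperator ℂ M) (s p : ℤ) (a : V) (v : M) (N : ℕ)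
    (h : ∀ n, p + N ≤ n → mode Y a n v = 0) :
    residue Y s p a v = ∑ j ∈ Finset.range N, Ring.choose s j • mode Y a (p + j) v :=
  finsum_eq_sum_range N fun j hj => by rw [h _ (by omega), smul_zero]

theorem residue_eq_zero (Y : V →ₗ[ℂ] VertexOperator ℂ M) (s p : ℤ) (a : V) (v : M)
    (h : ∀ n, p ≤ n → mode Y a n v = 0) : residue Y s p a v = 0 := by
  rw [residue_eq_sum Y s p a v 0 (by simpa using h)]; simp

theorem residue_zero_left (Y : V →ₗ[ℂ] VertexOperator ℂ M) (p : ℤ) (a : V) (v : M) :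
    residue Y 0 p a v = mode Y a p v := by
  rw [residue_apply, finsum_eq_single _ 0]
  · simp
  · intro j hj
    obtain ⟨j, rfl⟩ := Nat.exists_eq_succ_of_ne_zero hj
    rw [Nat.succ_eq_add_one, Ring.choose_zero_succ, zero_smul]

theorem residue_succ (Y : V →ₗ[ℂ] VertexOperator ℂ M) (s p : ℤ) (a : V) (v : M) :
    residue Y (s + 1) p a v = residue Y s p a v + residue Y s (p + 1) a v := by
  obtain ⟨N, hN⟩ := exists_mode_eq_zero Y a v
  obtain ⟨K, hK⟩ : ∃ K : ℕ, N ≤ p + K := ⟨(N - p).toNat, by omega⟩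
  rw [residue_eq_sum Y (s + 1) p a v (K + 1) (fun n hn => hN n (by omega)),
    residue_eq_sum Y s p a v (K + 1) (fun n hn => hN n (by omega)),
    residue_eq_sum Y s (p + 1) a v K (fun n hn => hN n (by omega)),
    Finset.sum_range_succ', Finset.sum_range_succ' (n := K), add_right_comm,
    ← Finset.sum_add_distrib]
  congr 1
  · refine Finset.sum_congr rfl fun j _ => ?_
    rw [Ring.choose_succ_succ, add_smul, add_comm]
    push_cast
    congr 3
    ring_nf
  · simp

/-- A function on `ℤ × ℤ` with Pascal's rule that vanishes on one row and far out on each row. -/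
theorem eq_zero_of_pascal (D : ℤ → ℤ → M) (hD : ∀ s p, D (s + 1) p = D s p + D s (p + 1))
    (h0 : ∀ p, D 0 p = 0) (hbig : ∀ s, ∃ N, ∀ p, N ≤ p → D s p = 0) (s p : ℤ) : D s p = 0 := by
  induction s using Int.induction_on generalizing p with
  | zero => exact h0 p
  | succ s ih => rw [hD, ih, ih, add_zero]
  | pred s ih =>
    obtain ⟨N, hN⟩ := hbig (-(s : ℤ) - 1)
    have step : ∀ q, D (-(s : ℤ) - 1) (q + 1) = 0 → D (-(s : ℤ) - 1) q = 0 := fun q hq => by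
      have := hD (-(s : ℤ) - 1) q
      rw [hq, sub_add_cancel, ih, add_zero] at this
      exact this.symm
    have : ∀ (d : ℕ) (q : ℤ), N ≤ q + d → D (-(s : ℤ) - 1) q = 0 := by
      intro d
      induction d with
      | zero => exact fun q hq => hN q (by simpa using hq)
      | succ d ih' => exact fun q hq => step q (ih' (q + 1) (by push_cast at hq; omega))
    exact this (N - p).toNat p (by omega)

theorem sum_antidiagonal_choose_succ (s : ℤ) (j : ℕ) (g : ℕ → ℕ → M) :
    ∑ x ∈ Finset.HasAntidiagonal.antidiagonal (j + 1), Ring.choose (s + 1) x.1 • g x.1 x.2 =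
      ∑ x ∈ Finset.HasAntidiagonal.antidiagonal (j + 1), Ring.choose s x.1 • g x.1 x.2 +
        ∑ x ∈ Finset.HasAntidiagonal.antidiagonal j, Ring.choose s x.1 • g (x.1 + 1) x.2 := by
  rw [Finset.Nat.sum_antidiagonal_succ, Finset.Nat.sum_antidiagonal_succ, add_assoc,
    ← Finset.sum_add_distrib]
  congr 1
  · simp
  · refine Finset.sum_congr rfl fun x _ => ?_
    rw [Ring.choose_succ_succ, add_smul, add_comm]

theorem sum_antidiagonal_choose_succ' (s : ℤ) (j : ℕ) (g : ℕ → ℕ → M) :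
    ∑ x ∈ Finset.HasAntidiagonal.antidiagonal (j + 1), Ring.choose (s + 1) x.2 • g x.1 x.2 =
      ∑ x ∈ Finset.HasAntidiagonal.antidiagonal (j + 1), Ring.choose s x.2 • g x.1 x.2 +
        ∑ x ∈ Finset.HasAntidiagonal.antidiagonal j, Ring.choose s x.2 • g x.1 (x.2 + 1) := by
  rw [Finset.Nat.sum_antidiagonal_succ', Finset.Nat.sum_antidiagonal_succ', add_assoc,
    ← Finset.sum_add_distrib]
  congr 1
  · simp
  · refine Finset.sum_congr rfl fun x _ => ?_
    rw [Ring.choose_succ_succ, add_smul, add_comm]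

/-- Coefficients of the `j`-th divided derivative of `(1 + z)ˢ zᵖ`. -/
def hasse (F : ℤ → ℤ → M) (s p : ℤ) (j : ℕ) : M :=
  ∑ x ∈ Finset.HasAntidiagonal.antidiagonal j,
    Ring.choose s x.1 • Ring.choose p x.2 • F (s - x.1) (p - x.2)

theorem hasse_succ (F : ℤ → ℤ → M) (hF : ∀ s p, F (s + 1) p = F s p + F s (p + 1))
    (s p : ℤ) (j : ℕ) : hasse F (s + 1) p j = hasse F s p j + hasse F s (p + 1) j := by
  cases j with
  | zero => simp [hasse, hF]
  | succ j =>
    unfold hasse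
    rw [sum_antidiagonal_choose_succ s j
      (fun x y => Ring.choose p y • F (s + 1 - x) (p - y))]
    have h2 := sum_antidiagonal_choose_succ' p j
      (fun x y => Ring.choose s x • F (s - x) (p + 1 - y))
    have h3 : ∑ x ∈ Finset.HasAntidiagonal.antidiagonal (j + 1),
        Ring.choose s x.1 • Ring.choose (p + 1) x.2 • F (s - x.1) (p + 1 - x.2) =
        ∑ x ∈ Finset.HasAntidiagonal.antidiagonal (j + 1),
          Ring.choose (p + 1) x.2 • Ring.choose s x.1 • F (s - x.1) (p + 1 - x.2) :=
      Finset.sum_congr rfl fun x _ => smul_comm _ _ _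
    rw [h3, h2, ← add_assoc, ← Finset.sum_add_distrib]
    congr 1
    · refine Finset.sum_congr rfl fun x _ => ?_
      rw [smul_comm (Ring.choose p x.2), ← smul_add, ← smul_add,
        show s + 1 - (x.1 : ℤ) = s - x.1 + 1 by ring, hF,
        show p + 1 - (x.2 : ℤ) = p - x.2 + 1 by ring]
    · refine Finset.sum_congr rfl fun x _ => ?_
      rw [smul_comm (Ring.choose p x.2)]
      push_cast
      congr 3 <;> ring

theorem hasse_eq_zero (F : ℤ → ℤ → M) (s p : ℤ) (j : ℕ) (h : ∀ s' p', p ≤ p' + j → F s' p' = 0) :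
    hasse F s p j = 0 := by
  refine Finset.sum_eq_zero fun x hx => ?_
  have : x.1 + x.2 = j := by simpa using hx
  rw [h _ _ (by omega), smul_zero, smul_zero]

theorem exists_mode_eq_zero_of_lt (Y : V →ₗ[ℂ] VertexOperator ℂ M) (b : ℕ → V) (v : ℕ → M)
    (J : ℕ) : ∃ N : ℤ, ∀ j < J, ∀ n, N ≤ n → mode Y (b j) n (v j) = 0 := by
  induction J with
  | zero => exact ⟨0, by simp⟩
  | succ J ih =>
    obtain ⟨N, hN⟩ := ih
    obtain ⟨N', hN'⟩ := exists_mode_eq_zero Y (b J) (v J)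
    refine ⟨max N N', fun j hj n hn => ?_⟩
    rcases Nat.lt_succ_iff_lt_or_eq.mp hj with h | rfl
    · exact hN j h n (by omega)
    · exact hN' n (by omega)

end Residues

section Jacobi

variable {V M : Type*} [AddCommGroup V] [Module ℂ V] [AddCommGroup M] [Module ℂ M]
  {A : VertexOperatorAlgebra V} (W : WeakModule A M)

def jacobiLeft (n s p t q : ℤ) (a b : V) (v : M) (j : ℕ) : M :=
  hasse (fun s' p' => residue W.Y (s' + t) (p' + q) (mode A.Y a (n + j) b) v) s p j

def jacobiRight (n s p t q : ℤ) (a b : V) (v : M) (i : ℕ) : M :=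
  ((-1) ^ i * Ring.choose n i) •
    (residue W.Y s (p + n - i) a (residue W.Y t (q + i) b v) -
      (-1 : ℂ) ^ n • residue W.Y t (q + n - i) b (residue W.Y s (p + i) a v))

theorem exists_jacobiLeft_eq_zero (n : ℤ) (a b : V) : ∃ J : ℕ, ∀ (s p t q : ℤ) (v : M) (j : ℕ),
    J ≤ j → jacobiLeft W n s p t q a b v j = 0 := by
  obtain ⟨N, hN⟩ := exists_mode_eq_zero A.Y a b
  refine ⟨(N - n).toNat, fun s p t q v j hj => hasse_eq_zero _ _ _ _ fun s' p' _ => ?_⟩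
  simp [hN (n + j) (by omega)]

theorem exists_jacobiRight_eq_zero (n p q : ℤ) (a b : V) (v : M) : ∃ I : ℕ, ∀ (s t : ℤ) (i : ℕ),
    I ≤ i → jacobiRight W n s p t q a b v i = 0 := by
  obtain ⟨N, hN⟩ := exists_mode_eq_zero W.Y a v
  obtain ⟨K, hK⟩ := exists_mode_eq_zero W.Y b v
  refine ⟨(N - p).toNat + (K - q).toNat, fun s t i hi => ?_⟩
  rw [jacobiRight, residue_eq_zero W.Y t _ b v fun m hm => hK m (by omega),
    residue_eq_zero W.Y s _ a v fun m hm => hN m (by omega)]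
  simp

theorem jacobiLeft_eq_zero_of_large (n : ℤ) (a b : V) (v : M) : ∃ N : ℤ, ∀ s p t q : ℤ,
    N ≤ p + q → ∀ j, jacobiLeft W n s p t q a b v j = 0 := by
  obtain ⟨J, hJ⟩ := exists_jacobiLeft_eq_zero W n a b
  obtain ⟨N, hN⟩ := exists_mode_eq_zero_of_lt W.Y (fun j => mode A.Y a (n + j) b) (fun _ => v) J
  refine ⟨N + J, fun s p t q h j => ?_⟩
  by_cases hj : J ≤ j
  · exact hJ _ _ _ _ _ _ hj
  · exact hasse_eq_zero _ _ _ _ fun s' p' hp =>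
      residue_eq_zero _ _ _ _ _ fun m hm => hN j (by omega) m (by omega)

theorem jacobiRight_eq_zero_of_large_left (n t q : ℤ) (a b : V) (v : M) : ∃ N : ℤ, ∀ s p : ℤ,
    N ≤ p → ∀ i, jacobiRight W n s p t q a b v i = 0 := by
  obtain ⟨N, hN⟩ := exists_mode_eq_zero W.Y a v
  obtain ⟨K, hK⟩ := exists_mode_eq_zero W.Y b v
  obtain ⟨L, hL⟩ := exists_mode_eq_zero_of_lt W.Y (fun _ => a)
    (fun i => residue W.Y t (q + i) b v) (K - q).toNat
  refine ⟨max N (L - n + (K - q).toNat), fun s p hp i => ?_⟩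
  have h1 : residue W.Y s (p + n - i) a (residue W.Y t (q + i) b v) = 0 := by
    by_cases hi : (K - q).toNat ≤ i
    · rw [residue_eq_zero W.Y t _ b v fun m hm => hK m (by omega), map_zero]
    · exact residue_eq_zero _ _ _ _ _ fun m hm => hL i (by omega) m (by omega)
  rw [jacobiRight, h1, residue_eq_zero W.Y s _ a v fun m hm => hN m (by omega)]
  simp

theorem jacobiRight_eq_zero_of_large_right (n s p : ℤ) (a b : V) (v : M) : ∃ N : ℤ, ∀ t q : ℤ,
    N ≤ q → ∀ i, jacobiRight W n s p t q a b v i = 0 := by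
  obtain ⟨N, hN⟩ := exists_mode_eq_zero W.Y b v
  obtain ⟨K, hK⟩ := exists_mode_eq_zero W.Y a v
  obtain ⟨L, hL⟩ := exists_mode_eq_zero_of_lt W.Y (fun _ => b)
    (fun i => residue W.Y s (p + i) a v) (K - p).toNat
  refine ⟨max N (L - n + (K - p).toNat), fun t q hq i => ?_⟩
  have h1 : residue W.Y t (q + n - i) b (residue W.Y s (p + i) a v) = 0 := by
    by_cases hi : (K - p).toNat ≤ i
    · rw [residue_eq_zero W.Y s _ a v fun m hm => hK m (by omega), map_zero]
    · exact residue_eq_zero _ _ _ _ _ fun m hm => hL i (by omega) m (by omega)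
  rw [jacobiRight, h1, residue_eq_zero W.Y t _ b v fun m hm => hN m (by omega)]
  simp

def jacobiDefect (n s p t q : ℤ) (a b : V) (v : M) : M :=
  ∑ᶠ j, jacobiLeft W n s p t q a b v j - ∑ᶠ i, jacobiRight W n s p t q a b v i

theorem jacobiDefect_eq (n : ℤ) (a b : V) (v : M) (p q p' q' : ℤ) :
    ∃ K : ℕ, ∀ s t, (jacobiDefect W n s p t q a b v =
      ∑ j ∈ Finset.range K,
        (jacobiLeft W n s p t q a b v j - jacobiRight W n s p t q a b v j)) ∧
      (jacobiDefect W n s p' t q' a b v =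
      ∑ j ∈ Finset.range K,
        (jacobiLeft W n s p' t q' a b v j - jacobiRight W n s p' t q' a b v j)) := by
  obtain ⟨J, hJ⟩ := exists_jacobiLeft_eq_zero W n a b
  obtain ⟨I, hI⟩ := exists_jacobiRight_eq_zero W n p q a b v
  obtain ⟨I', hI'⟩ := exists_jacobiRight_eq_zero W n p' q' a b v
  refine ⟨J + I + I', fun s t => ⟨?_, ?_⟩⟩
  · rw [jacobiDefect, finsum_eq_sum_range (J + I + I') fun j hj => hJ s p t q v j (by omega),
      finsum_eq_sum_range (J + I + I') fun j hj => hI s t j (by omega), Finset.sum_sub_distrib]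
  · rw [jacobiDefect, finsum_eq_sum_range (J + I + I') fun j hj => hJ s p' t q' v j (by omega),
      finsum_eq_sum_range (J + I + I') fun j hj => hI' s t j (by omega), Finset.sum_sub_distrib]

theorem jacobiDefect_succ_left (n s p t q : ℤ) (a b : V) (v : M) :
    jacobiDefect W n (s + 1) p t q a b v =
      jacobiDefect W n s p t q a b v + jacobiDefect W n s (p + 1) t q a b v := by
  obtain ⟨K, hK⟩ := jacobiDefect_eq W n a b v p q (p + 1) q
  rw [(hK (s + 1) t).1, (hK s t).1, (hK s t).2, ← Finset.sum_add_distrib]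
  refine Finset.sum_congr rfl fun j _ => ?_
  have h1 : jacobiLeft W n (s + 1) p t q a b v j =
      jacobiLeft W n s p t q a b v j + jacobiLeft W n s (p + 1) t q a b v j := by
    refine hasse_succ _ (fun s' p' => ?_) s p j
    rw [add_right_comm s', residue_succ, add_right_comm p']
  have h2 : jacobiRight W n (s + 1) p t q a b v j =
      jacobiRight W n s p t q a b v j + jacobiRight W n s (p + 1) t q a b v j := by
    simp only [jacobiRight, residue_succ, map_add, ← smul_add]
    rw [show p + n - (j : ℤ) + 1 = p + 1 + n - j by ring,
      show p + (j : ℤ) + 1 = p + 1 + j by ring, smul_add]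
    congr 1
    abel
  rw [h1, h2]
  abel

theorem jacobiDefect_succ_right (n s p t q : ℤ) (a b : V) (v : M) :
    jacobiDefect W n s p (t + 1) q a b v =
      jacobiDefect W n s p t q a b v + jacobiDefect W n s p t (q + 1) a b v := by
  obtain ⟨K, hK⟩ := jacobiDefect_eq W n a b v p q p (q + 1)
  rw [(hK s (t + 1)).1, (hK s t).1, (hK s t).2, ← Finset.sum_add_distrib]
  refine Finset.sum_congr rfl fun j _ => ?_
  have h1 : jacobiLeft W n s p (t + 1) q a b v j =
      jacobiLeft W n s p t q a b v j + jacobiLeft W n s p t (q + 1) a b v j := by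
    simp only [jacobiLeft, hasse, ← add_assoc, residue_succ, smul_add, Finset.sum_add_distrib]
  have h2 : jacobiRight W n s p (t + 1) q a b v j =
      jacobiRight W n s p t q a b v j + jacobiRight W n s p t (q + 1) a b v j := by
    simp only [jacobiRight, residue_succ, map_add, ← smul_add]
    rw [show q + n - (j : ℤ) + 1 = q + 1 + n - j by ring,
      show q + (j : ℤ) + 1 = q + 1 + j by ring, smul_add]
    congr 1
    abel
  rw [h1, h2]
  abel

theorem hasse_zero_left (F : ℤ → ℤ → M) (p : ℤ) (j : ℕ) :
    hasse F 0 p j = Ring.choose p j • F 0 (p - j) := by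
  rw [hasse, Finset.sum_eq_single (0, j)]
  · simp
  · rintro ⟨x, y⟩ hx hne
    obtain ⟨x, rfl⟩ : ∃ x', x = x' + 1 := by
      refine Nat.exists_eq_succ_of_ne_zero ?_
      rintro rfl
      simp at hx
      exact hne (by rw [hx])
    simp [Ring.choose_zero_succ]
  · simp

theorem jacobiDefect_eq_zero (n s p t q : ℤ) (a b : V) (v : M) :
    jacobiDefect W n s p t q a b v = 0 := by
  have h0 : ∀ p t q, jacobiDefect W n 0 p t q a b v = 0 := by
    intro p
    refine eq_zero_of_pascal _ (fun t q => jacobiDefect_succ_right W n 0 p t q a b v) ?_ ?_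
    · intro q
      rw [jacobiDefect, sub_eq_zero]
      convert W.jacobi a b v p n q using 3 with j i
      · rw [jacobiLeft, hasse_zero_left, add_zero, residue_zero_left, sub_add_eq_add_sub]
      · simp only [jacobiRight, residue_zero_left, add_comm n q]
    · intro t
      obtain ⟨N, hN⟩ := jacobiLeft_eq_zero_of_large W n a b v
      obtain ⟨K, hK⟩ := jacobiRight_eq_zero_of_large_right W n 0 p a b v
      refine ⟨max K (N - p), fun q hq => ?_⟩
      simp [jacobiDefect, hN 0 p t q (by omega), hK t q (by omega)]
  refine eq_zero_of_pascal (fun s p => jacobiDefect W n s p t q a b v)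
    (fun s p => jacobiDefect_succ_left W n s p t q a b v) (fun p => h0 p t q) (fun s => ?_) s p
  obtain ⟨N, hN⟩ := jacobiLeft_eq_zero_of_large W n a b v
  obtain ⟨K, hK⟩ := jacobiRight_eq_zero_of_large_left W n t q a b v
  refine ⟨max K (N - q), fun p hp => ?_⟩
  simp [jacobiDefect, hN s p t q (by omega), hK s p (by omega)]

theorem residue_jacobi (n s p t q : ℤ) (a b : V) (v : M) :
    ∑ᶠ j, jacobiLeft W n s p t q a b v j = ∑ᶠ i, jacobiRight W n s p t q a b v i :=
  sub_eq_zero.mp (jacobiDefect_eq_zero W n s p t q a b v)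

end Jacobi

section Zhu

variable {V M : Type*} [AddCommGroup V] [Module ℂ V] [AddCommGroup M] [Module ℂ M]
  {A : VertexOperatorAlgebra V} (W : WeakModule A M)

/-- `O(M)`, spanned by `Res_z Y(a, z) v (1 + z)^(wt a) / z²` for homogeneous `a` and `v ∈ M`. -/
def WeakModule.O : Submodule ℂ M :=
  Submodule.span ℂ {x | ∃ (k : ℤ) (a : V) (v : M), a ∈ A.wt k ∧ x = residue W.Y k (-2) a v}

/-- Decomposition of a vector of `V` into homogeneous components. -/
def VertexOperatorAlgebra.decompose (A : VertexOperatorAlgebra V) :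
    V ≃ₗ[ℂ] DirectSum ℤ fun k => A.wt k :=
  (LinearEquiv.ofBijective (DirectSum.coeLinearMap A.wt) A.isInternal_wt).symm

/-- The bilinear map with `(a, v) ↦ Res_z Y(a, z) v (1 + z)^(wt a - e) / z` for homogeneous `a`. -/
def WeakModule.star (e : ℤ) : V →ₗ[ℂ] M →ₗ[ℂ] M :=
  (DirectSum.toModule ℂ ℤ (M →ₗ[ℂ] M) fun k =>
    (residue W.Y (k - e) (-1)).comp (A.wt k).subtype).comp A.decompose.toLinearMap

theorem WeakModule.star_apply (e k : ℤ) {a : V} (ha : a ∈ A.wt k) (v : M) :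
    W.star e a v = residue W.Y (k - e) (-1) a v := by
  have : A.decompose a = DirectSum.lof ℂ ℤ (fun k => A.wt k) k ⟨a, ha⟩ := by
    exact (LinearEquiv.symm_apply_eq _).mpr (DirectSum.coeLinearMap_lof A.wt k ⟨a, ha⟩).symm
  simp [star, this]

theorem mode_mode_vacuum (a : V) (n : ℤ) (v : M) :
    mode W.Y (mode A.Y a (-2) A.vacuum) n v = -(n : ℂ) • mode W.Y a (n - 1) v := by
  have hc : ∀ i : ℕ, ((-1) ^ i * Ring.choose (-2 : ℤ) i) = (i : ℤ) + 1 := by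
    intro i
    rw [Ring.choose_neg', Ring.multichoose_two, Int.negOnePow_def, Units.smul_def]
    rcases Nat.even_or_odd i with h | h <;> simp [h]
  have h := W.jacobi a A.vacuum v 0 (-2) n
  rw [finsum_eq_single _ 0 (by
    intro i hi
    obtain ⟨i, rfl⟩ := Nat.exists_eq_succ_of_ne_zero hi
    rw [Nat.succ_eq_add_one, Ring.choose_zero_succ, zero_smul])] at h
  simp only [hc, W.vacuum_mode] at h
  simp only [Ring.choose_zero_right, one_smul, CharP.cast_eq_zero, add_zero, zero_add,
    sub_zero] at h
  rw [h]
  rcases lt_trichotomy n 0 with hn | rfl | hn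
  · rw [finsum_eq_single _ (-1 - n).toNat]
    · rw [if_pos (by omega), if_neg (by omega), smul_zero, sub_zero,
        show -2 - (((-1 - n).toNat : ℕ) : ℤ) = n - 1 by omega,
        show (((-1 - n).toNat : ℕ) : ℤ) + 1 = -n by omega, ← Int.cast_smul_eq_zsmul ℂ]
      simp
    · intro i hi
      rw [if_neg (by omega), if_neg (by omega)]
      simp
  · rw [finsum_eq_zero_of_forall_eq_zero]
    · simp
    · intro i
      rw [if_neg (by omega), if_neg (by omega)]
      simp
  · rw [finsum_eq_single _ (n - 1).toNat]
    · rw [if_neg (by omega), if_pos (by omega),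
        show (((n - 1).toNat : ℕ) : ℤ) = n - 1 by omega, ← Int.cast_smul_eq_zsmul ℂ]
      simp
    · intro i hi
      rw [if_neg (by omega), if_neg (by omega)]
      simp

theorem residue_mode_vacuum (s p : ℤ) (a : V) (v : M) :
    residue W.Y s p (mode A.Y a (-2) A.vacuum) v +
      (s • residue W.Y (s - 1) p a v + p • residue W.Y s (p - 1) a v) = 0 := by
  refine eq_zero_of_pascal (fun s p => residue W.Y s p (mode A.Y a (-2) A.vacuum) v +
      (s • residue W.Y (s - 1) p a v + p • residue W.Y s (p - 1) a v)) ?_ ?_ ?_ s p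
  · intro s p
    have h1 := residue_succ W.Y (s - 1) p a v
    have h2 := residue_succ W.Y s (p - 1) a v
    simp only [sub_add_cancel] at h1 h2
    simp only [residue_succ, add_sub_cancel_right, h2]
    rw [h1]
    simp only [smul_add, add_smul, one_smul]
    abel
  · intro p
    rw [residue_zero_left, residue_zero_left, mode_mode_vacuum, ← Int.cast_smul_eq_zsmul ℂ p]
    simp
  · intro s
    obtain ⟨N, hN⟩ := exists_mode_eq_zero W.Y a v
    obtain ⟨K, hK⟩ := exists_mode_eq_zero W.Y (mode A.Y a (-2) A.vacuum) v
    refine ⟨max (N + 1) K, fun p hp => ?_⟩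
    rw [residue_eq_zero _ _ _ _ _ fun n hn => hK n (by omega),
      residue_eq_zero _ _ p a _ fun n hn => hN n (by omega),
      residue_eq_zero _ _ _ a _ fun n hn => hN n (by omega)]
    simp

theorem residue_mem_O_aux (m : ℕ) : ∀ (k : ℤ) (a : V) (v : M), a ∈ A.wt k →
    residue W.Y k (-2 - m) a v ∈ W.O := by
  induction m with
  | zero => exact fun k a v ha => Submodule.subset_span ⟨k, a, v, ha, by simp⟩
  | succ m ih =>
    intro k a v ha
    have hD : mode A.Y a (-2) A.vacuum ∈ A.wt (k + 1) := by
      have := A.mode_mem k 0 (-2) a A.vacuum ha A.vacuum_mem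
      rwa [show k + 0 - -2 - 1 = k + 1 by ring] at this
    have h1 := ih (k + 1) _ v hD
    have h2 := ih k a v ha
    have h3 := residue_mode_vacuum W (k + 1) (-2 - m) a v
    rw [residue_succ W.Y k (-2 - m - 1), sub_add_cancel, add_sub_cancel_right,
      show (-2 - (m : ℤ) - 1) = -2 - ((m + 1 : ℕ) : ℤ) by push_cast; ring] at h3
    have h4 : ((m : ℂ) + 2) • residue W.Y k (-2 - ((m + 1 : ℕ) : ℤ)) a v ∈ W.O := by
      have h5 : ((m : ℂ) + 2) • residue W.Y k (-2 - ((m + 1 : ℕ) : ℤ)) a v =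
          residue W.Y (k + 1) (-2 - m) (mode A.Y a (-2) A.vacuum) v +
            (k - 1 - m : ℂ) • residue W.Y k (-2 - m) a v := by
        rw [← sub_eq_zero, ← neg_eq_zero, ← h3, ← Int.cast_smul_eq_zsmul ℂ,
          ← Int.cast_smul_eq_zsmul ℂ]
        push_cast
        module
      rw [h5]
      exact add_mem h1 (W.O.smul_mem _ h2)
    exact (W.O.smul_mem_iff (by exact_mod_cast (show m + 2 ≠ 0 by omega))).mp h4

theorem residue_mem_O (n m : ℕ) (hnm : n ≤ m) (k : ℤ) (a : V) (v : M) (ha : a ∈ A.wt k)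
    (s p : ℤ) (hs : s = k + n) (hp : p = -2 - m) : residue W.Y s p a v ∈ W.O := by
  subst hs hp
  induction n generalizing m with
  | zero => simpa using residue_mem_O_aux W m k a v ha
  | succ n ih =>
    obtain ⟨m, rfl⟩ : ∃ m', m = m' + 1 := ⟨m - 1, by omega⟩
    rw [Nat.cast_succ, ← add_assoc, residue_succ]
    refine add_mem (ih _ (by omega)) ?_
    have := ih m (by omega)
    rwa [show -2 - ((m + 1 : ℕ) : ℤ) + 1 = -2 - m by push_cast; ring]

theorem finsum_mem_submodule (S : Submodule ℂ M) (f : ℕ → M) (h : ∀ i, f i ∈ S) :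
    ∑ᶠ i, f i ∈ S :=
  finsum_induction (· ∈ S) S.zero_mem (fun _ _ => S.add_mem) h

theorem zsmul_mem_submodule (S : Submodule ℂ M) (c : ℤ) {x : M} (h : x ∈ S) : c • x ∈ S :=
  S.toAddSubgroup.zsmul_mem h c

/-- `V * O(M) ⊆ O(M)` (`e = 0`) and `O(M) * V ⊆ O(M)` (`e = 1`). -/
theorem star_mem_O (e : ℤ) (he : e = 0 ∨ e = 1) (a : V) (x : M) (hx : x ∈ W.O) :
    W.star e a x ∈ W.O := by
  have key : ∀ k, ∀ a ∈ A.wt k, W.star e a x ∈ W.O := by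
    intro k a ha
    refine Submodule.span_induction (p := fun x _ => W.star e a x ∈ W.O) ?_ (by simp) ?_ ?_ hx
    · rintro _ ⟨l, b, v, hb, rfl⟩
      have h := residue_jacobi W 0 (k - e) (-1) l (-2) a b v
      rw [finsum_eq_single (jacobiRight W 0 (k - e) (-1) l (-2) a b v) 0 (by
        intro i hi
        obtain ⟨i, rfl⟩ := Nat.exists_eq_succ_of_ne_zero hi
        rw [jacobiRight, Nat.succ_eq_add_one, Ring.choose_zero_succ, mul_zero, zero_smul])] at h
      simp only [jacobiRight, pow_zero, Ring.choose_zero_right, one_mul, one_smul, add_zero,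
        CharP.cast_eq_zero, sub_zero, zpow_zero] at h
      rw [W.star_apply e k ha, ← sub_add_cancel (residue W.Y (k - e) (-1) a _)
        (residue W.Y l (-2) b (residue W.Y (k - e) (-1) a v)), ← h]
      refine add_mem (finsum_mem_submodule W.O _ fun j => ?_)
        (Submodule.subset_span ⟨l, b, _, hb, rfl⟩)
      rw [jacobiLeft, hasse]
      refine Submodule.sum_mem W.O fun y hy => ?_
      have hy' : y.1 + y.2 = j := by simpa using hy
      refine zsmul_mem_submodule _ _ (zsmul_mem_submodule _ _ ?_)
      refine residue_mem_O W (y.2 + 1 - e).toNat (y.2 + 1) (by omega) _ _ v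
        (A.mode_mem k l (0 + j) a b ha hb) _ _ ?_ ?_
      · omega
      · push_cast; ring
    · intro x y _ _ hx hy
      rw [map_add]
      exact add_mem hx hy
    · intro c x _ hx
      rw [map_smul]
      exact W.O.smul_mem _ hx
  have hmem : a ∈ ⨆ k, A.wt k := by
    rw [A.isInternal_wt.submodule_iSup_eq_top]; trivial
  refine Submodule.iSup_induction A.wt (motive := fun a => W.star e a x ∈ W.O) hmem key
    (by simp) fun a b ha hb => ?_
  rw [map_add, LinearMap.add_apply]
  exact add_mem ha hb

/-- `O(V) * M ⊆ O(M)` (`e = 0`) and `M * O(V) ⊆ O(M)` (`e = 1`). -/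
theorem star_mem_O_of_mem (e : ℤ) (he : e = 0 ∨ e = 1) (c : V) (hc : c ∈ A.adjoint.O) (v : M) :
    W.star e c v ∈ W.O := by
  refine Submodule.span_induction (p := fun c _ => W.star e c v ∈ W.O) ?_ (by simp) ?_ ?_ hc
  · rintro _ ⟨k, a, b, ha, rfl⟩
    have hb : b ∈ ⨆ l, A.wt l := by
      rw [A.isInternal_wt.submodule_iSup_eq_top]; trivial
    refine Submodule.iSup_induction A.wt
      (motive := fun b => W.star e (residue A.Y k (-2) a b) v ∈ W.O) hb ?_ (by simp) ?_
    · intro l b hb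
      obtain ⟨J, hJ⟩ := exists_jacobiLeft_eq_zero W (-2) a b
      obtain ⟨N, hN⟩ := exists_mode_eq_zero A.Y a b
      have h := residue_jacobi W (-2) k 0 (l + 1 - e) (-1) a b v
      rw [finsum_eq_sum_range (J + (N + 2).toNat) fun j hj => hJ _ _ _ _ _ j (by omega)] at h
      have h' : W.star e (residue A.Y k (-2) a b) v =
          ∑ j ∈ Finset.range (J + (N + 2).toNat),
            jacobiLeft W (-2) k 0 (l + 1 - e) (-1) a b v j := by
        rw [residue_eq_sum A.Y k (-2) a b (J + (N + 2).toNat) fun n hn => hN n (by omega),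
          map_sum, LinearMap.sum_apply]
        refine Finset.sum_congr rfl fun j _ => ?_
        rw [map_zsmul, LinearMap.smul_apply, W.star_apply e _ (A.mode_mem k l _ a b ha hb),
          jacobiLeft, hasse, Finset.sum_eq_single (j, 0)]
        · simp only [Ring.choose_zero_right, one_smul, CharP.cast_eq_zero, sub_zero]
          congr 4
          ring
        · rintro ⟨x, y⟩ hx hne
          obtain ⟨y, rfl⟩ : ∃ y', y = y' + 1 := by
            refine Nat.exists_eq_succ_of_ne_zero ?_
            rintro rfl
            simp at hx
            exact hne (by rw [hx])
          simp [Ring.choose_zero_succ]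
        · simp
      rw [h', h]
      refine finsum_mem_submodule _ _ fun i => zsmul_mem_submodule _ _ (sub_mem ?_ ?_)
      · exact residue_mem_O W 0 i (by omega) k a _ ha _ _ (by simp) (by ring)
      · refine W.O.smul_mem _ (residue_mem_O W (1 - e).toNat (i + 1) (by omega) l b _ hb _ _ ?_ ?_)
        · omega
        · push_cast; ring
    · intro b b' h h'
      rw [map_add, map_add, LinearMap.add_apply]
      exact add_mem h h'
  · intro x y _ _ hx hy
    rw [map_add, LinearMap.add_apply]
    exact add_mem hx hy
  · intro c x _ hx
    rw [map_smul, LinearMap.smul_apply]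
    exact W.O.smul_mem _ hx

/-- Zhu's algebra `A(V) = V / O(V)`. -/
abbrev VertexOperatorAlgebra.ZhuAlgebra (A : VertexOperatorAlgebra V) : Type _ :=
  V ⧸ A.adjoint.O

/-- The `A(V)`-bimodule `A(M) = M / O(M)`. -/
abbrev WeakModule.ZhuBimodule : Type _ :=
  M ⧸ W.O

/-- The bilinear map induced by `star e` on the quotients. -/
def WeakModule.act (e : ℤ) (he : e = 0 ∨ e = 1) :
    A.ZhuAlgebra →ₗ[ℂ] W.ZhuBimodule →ₗ[ℂ] W.ZhuBimodule :=
  A.adjoint.O.liftQ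
    { toFun := fun a => W.O.mapQ W.O (W.star e a) fun x hx => star_mem_O W e he a x hx
      map_add' := fun a b => Submodule.linearMap_qext _ (LinearMap.ext fun v => by simp)
      map_smul' := fun c a => Submodule.linearMap_qext _ (LinearMap.ext fun v => by simp) }
    fun c hc => Submodule.linearMap_qext _ (LinearMap.ext fun v => by
      simpa using star_mem_O_of_mem W e he c hc v)

/-- The left action of `A(V)` on `A(M)`, `(a, v) ↦ a * v`, induced by
`a * v = Res_z Y(a, z) v (1 + z)^(wt a) / z` for homogeneous `a`.
For `M = V` it is the product of `A(V)`. -/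
def WeakModule.leftAct : A.ZhuAlgebra →ₗ[ℂ] W.ZhuBimodule →ₗ[ℂ] W.ZhuBimodule :=
  W.act 0 (Or.inl rfl)

/-- The right action of `A(V)` on `A(M)`, `(a, v) ↦ v * a`, induced by
`v * a = Res_z Y(a, z) v (1 + z)^(wt a - 1) / z` for homogeneous `a`. -/
def WeakModule.rightAct : A.ZhuAlgebra →ₗ[ℂ] W.ZhuBimodule →ₗ[ℂ] W.ZhuBimodule :=
  W.act 1 (Or.inr rfl)

theorem WeakModule.leftAct_mk (k : ℤ) {a : V} (ha : a ∈ A.wt k) (v : M) :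
    W.leftAct (A.adjoint.O.mkQ a) (W.O.mkQ v) = W.O.mkQ (residue W.Y k (-1) a v) := by
  have := W.star_apply 0 k ha v
  rw [sub_zero] at this
  rw [← this]
  rfl

theorem WeakModule.rightAct_mk (k : ℤ) {a : V} (ha : a ∈ A.wt k) (v : M) :
    W.rightAct (A.adjoint.O.mkQ a) (W.O.mkQ v) = W.O.mkQ (residue W.Y (k - 1) (-1) a v) := by
  rw [← W.star_apply 1 k ha v]
  rfl

/-- `A(V)ₙ`, the image of `⨁_{0 ≤ k ≤ n} Vₖ` in `A(V)`; it is zero for `n < 0`. -/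
def VertexOperatorAlgebra.filtration (A : VertexOperatorAlgebra V) (n : ℤ) :
    Submodule ℂ A.ZhuAlgebra :=
  (⨆ (k : ℤ) (_ : 0 ≤ k ∧ k ≤ n), A.wt k).map A.adjoint.O.mkQ

/-- `A(M)ₙ`, the image of `⨁_{0 ≤ k ≤ n} M(k)` in `A(M)`. -/
def AdmissibleModule.filtration (W : AdmissibleModule A M) (n : ℕ) :
    Submodule ℂ W.ZhuBimodule :=
  (⨆ (k : ℕ) (_ : k ≤ n), W.gr k).map W.O.mkQ

/-- The vectors `a¹₍₋ₙ₁₎ ⋯ aᵏ₍₋ₙₖ₎ w` with `w ∈ S`, `k ≥ 0`, `aⁱ ∈ V₊` homogeneous, `nᵢ ≥ 1`. -/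
inductive WeakModule.IsMonomial (W : WeakModule A M) (S : Set M) : M → Prop
  | base (w : M) (hw : w ∈ S) : WeakModule.IsMonomial W S w
  | step (k : ℤ) (a : V) (n : ℕ) (v : M) (hk : 1 ≤ k) (ha : a ∈ A.wt k) (hn : 1 ≤ n)
      (hv : WeakModule.IsMonomial W S v) :
      WeakModule.IsMonomial W S (mode W.Y a (-(n : ℤ)) v)

/-- `M` is strongly generated by the subset `S`. -/
def WeakModule.StronglyGeneratedBy (S : Set M) : Prop :=
  Submodule.span ℂ {x | W.IsMonomial S x} = ⊤

end Zhu

end VOA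

end

/-! Everything rests on comparing a mode with a residue. For `a` of weight `k` and `v` of degree
`m`, `Res_z Y(a,z) v (1+z)^s z^p` is `a_p v` plus multiples of `a_{p+j} v` with `j ≥ 1`, and these
have strictly smaller degree. So modulo lower degree a mode may be replaced by the residue with any
power of `1+z`. With exponent `s = k`, `a_{-1} v` becomes `a * v`, while `a_{-q} v` with `q ≥ 2`
becomes an element of `O(M)`.

Left equality: use strong induction on the degree. A generator `w_i` is `1 * w_i`. A longer monomial
`a_{-q} v` has degree larger than that of `v`, because `a` has positive weight. Up to terms covered
by induction it is zero in `A(M)` (`q ≥ 2`) or equals `a * v` (`q = 1`). By induction `v` is a sum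
of elements `b * w_i`, and associativity `a * (b * w_i) = (a * b) * w_i` finishes, since the product
of `A(V)` respects its filtration. This step is `exists_gr_of_isMonomial`; strong generation enters
degree by degree through `gr_le_span`.

Right equality: `a * w - w * a` is a residue with `z^0` in place of `z^{-1}`, so its degree is below
that of the leading term. The left equality therefore implies the right one by induction, with no
need for associativity of the right action. -/

namespace VOA

/-! ### Associativity of the left action of Zhu's algebra -/

section ZhuAssociativity

variable {V M : Type*} [AddCommGroup V] [Module ℂ V] [AddCommGroup M] [Module ℂ M]
  {A : VertexOperatorAlgebra V} (W : WeakModule A M)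

/-- Associativity `(a * b) * v ≡ a * (b * v)` modulo `O(M)`. -/
theorem star_residue_sub_mem_O {k l : ℤ} {a b : V} (ha : a ∈ A.wt k) (hb : b ∈ A.wt l) (v : M) :
    W.star 0 (residue A.Y k (-1) a b) v -
      residue W.Y k (-1) a (residue W.Y l (-1) b v) ∈ W.O := by
  obtain ⟨J, hJ⟩ := exists_jacobiLeft_eq_zero W (-1) a b
  obtain ⟨I, hI⟩ := exists_jacobiRight_eq_zero W (-1) 0 (-1) a b v
  obtain ⟨N, hN⟩ := exists_mode_eq_zero A.Y a b
  -- The weights are `(1+z)^k z^0` for `a` and `(1+z)^l z^{-1}` for `b`. With `n = -1`, the term `i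
  -- = 0` on the right then contains `a * (b * v)`.
  have h := residue_jacobi W (-1) k 0 l (-1) a b v
  rw [finsum_eq_sum_range (J + (N + 1).toNat) fun j hj => hJ _ _ _ _ _ j (by omega),
    finsum_eq_sum_range (I + 1) fun i hi => hI k l i (by omega)] at h
  have hstar : W.star 0 (residue A.Y k (-1) a b) v =
      ∑ j ∈ Finset.range (J + (N + 1).toNat), jacobiLeft W (-1) k 0 l (-1) a b v j := by
    rw [residue_eq_sum A.Y k (-1) a b (J + (N + 1).toNat) fun n hn => hN n (by omega),
      map_sum, LinearMap.sum_apply]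
    refine Finset.sum_congr rfl fun j _ => ?_
    -- As `p = 0`, the binomials `Ring.choose 0 y` leave only `(j, 0)`. The remaining exponent `k -
    -- j + l` is exactly the weight of `a_{-1+j} b`.
    rw [map_zsmul, LinearMap.smul_apply, W.star_apply 0 _ (A.mode_mem k l _ a b ha hb),
      jacobiLeft, hasse, Finset.sum_eq_single (j, 0)]
    · simp only [Ring.choose_zero_right, one_smul, CharP.cast_eq_zero, sub_zero]
      congr 4
      ring
    · rintro ⟨x, y⟩ hx hne
      obtain ⟨y, rfl⟩ : ∃ z, y = z + 1 := by
        refine Nat.exists_eq_succ_of_ne_zero ?_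
        rintro rfl
        simp at hx
        exact hne (by rw [hx])
      simp [Ring.choose_zero_succ]
    · simp
  have hsnd (i : ℕ) : residue W.Y l (-1 + -1 - i) b (residue W.Y k (0 + i) a v) ∈ W.O :=
    residue_mem_O W 0 i (by omega) l b _ hb _ _ (by simp) (by ring)
  -- The summand `i = 0` is split off: its first half cancels `a * (b * v)`. Every other residue has
  -- a power `z^{-2}` or lower and lies in `O(M)`.
  rw [hstar, h, Finset.sum_range_succ', add_sub_assoc]
  refine add_mem (Submodule.sum_mem _ fun i _ => zsmul_mem_submodule _ _ (sub_mem ?_ ?_)) ?_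
  · exact residue_mem_O W 0 i (by omega) k a _ ha _ _ (by simp) (by push_cast; ring)
  · exact W.O.smul_mem _ (hsnd _)
  · have := W.O.neg_mem (W.O.smul_mem ((-1 : ℂ) ^ (-1 : ℤ)) (hsnd 0))
    convert this using 1
    simp [jacobiRight]

theorem WeakModule.leftAct_leftAct {k l : ℤ} {a b : V} (ha : a ∈ A.wt k) (hb : b ∈ A.wt l)
    (v : M) :
    W.leftAct (A.adjoint.O.mkQ a) (W.leftAct (A.adjoint.O.mkQ b) (W.O.mkQ v)) =
      W.leftAct (A.adjoint.O.mkQ (residue A.Y k (-1) a b)) (W.O.mkQ v) := by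
  rw [W.leftAct_mk l hb, W.leftAct_mk k ha]
  exact ((Submodule.Quotient.eq _).mpr (star_residue_sub_mem_O W ha hb v)).symm

theorem WeakModule.leftAct_vacuum (v : M) :
    W.leftAct (A.adjoint.O.mkQ A.vacuum) (W.O.mkQ v) = W.O.mkQ v := by
  rw [W.leftAct_mk 0 A.vacuum_mem, residue_zero_left, W.vacuum_mode, if_pos rfl]

/-- This isolates the leading term: on a graded module the tail, with its larger mode indices, has
lower degree. -/
theorem residue_eq_mode_add_finsum (Y : V →ₗ[ℂ] VertexOperator ℂ M) (s p : ℤ) (a : V) (v : M) :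
    residue Y s p a v =
      mode Y a p v + ∑ᶠ j : ℕ, Ring.choose s (j + 1) • mode Y a (p + 1 + j) v := by
  obtain ⟨N, hN⟩ := exists_mode_eq_zero Y a v
  rw [residue_eq_sum Y s p a v ((N - p).toNat + 1) fun n hn => hN n (by omega),
    finsum_eq_sum_range (N - p).toNat fun j hj => by rw [hN _ (by omega), smul_zero],
    Finset.sum_range_succ', add_comm]
  congr 1
  · simp
  · refine Finset.sum_congr rfl fun j _ => ?_
    congr 3
    push_cast
    ring

end ZhuAssociativity

/-! ### Degree estimates for modes and residues -/

section Filtration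

variable {V M : Type*} [AddCommGroup V] [Module ℂ V] [AddCommGroup M] [Module ℂ M]
  {A : VertexOperatorAlgebra V} (W : AdmissibleModule A M)

/-- The sum of the `M(k)` with `k < n`. -/
noncomputable def AdmissibleModule.below (n : ℕ) : Submodule ℂ M :=
  ⨆ (k : ℕ) (_ : k < n), W.gr k

theorem AdmissibleModule.gr_le_below {k n : ℕ} (h : k < n) : W.gr k ≤ W.below n :=
  le_iSup₂_of_le k h le_rfl

theorem AdmissibleModule.filtration_eq (n : ℕ) :
    W.filtration n = (W.below (n + 1)).map W.O.mkQ := by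
  simp only [AdmissibleModule.filtration, AdmissibleModule.below, Nat.lt_succ_iff]

/-- The expected degree is an integer while the grading is indexed by `ℕ`; a negative value means
that the mode vanishes. -/
theorem AdmissibleModule.mode_mem_below {k m : ℤ} {d n : ℕ} {a : V} {v : M} (ha : a ∈ A.wt k)
    (hv : v ∈ W.gr d) (h : (d : ℤ) + k - m - 1 < n) : mode W.Y a m v ∈ W.below n := by
  rcases lt_or_ge ((d : ℤ) + k - m - 1) 0 with h0 | h0
  · rw [W.mode_eq_zero k m d a v ha hv h0]
    exact zero_mem _
  · obtain ⟨p, hp⟩ := Int.eq_ofNat_of_zero_le h0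
    exact W.gr_le_below (by omega) (W.mode_mem k m d p a v ha hv hp.symm)

theorem AdmissibleModule.residue_mem_below (s : ℤ) {k p : ℤ} {d n : ℕ} {a : V} {v : M}
    (ha : a ∈ A.wt k) (hv : v ∈ W.gr d) (h : (d : ℤ) + k - p - 1 < n) :
    residue W.Y s p a v ∈ W.below n := by
  rw [residue_apply]
  exact finsum_mem_submodule _ _ fun j =>
    zsmul_mem_submodule _ _ (W.mode_mem_below ha hv (by omega))

/-- The leading term cancels, and each remaining mode index exceeds `p`, so a bound `≤ n` on the
leading degree becomes `< n`. The exponent `s` is free and can be chosen to suit `O(M)` and the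
action. -/
theorem AdmissibleModule.mode_sub_residue_mem_below (s : ℤ) {k p : ℤ} {d n : ℕ} {a : V} {v : M}
    (ha : a ∈ A.wt k) (hv : v ∈ W.gr d) (h : (d : ℤ) + k - p - 1 ≤ n) :
    mode W.Y a p v - residue W.Y s p a v ∈ W.below n := by
  rw [residue_eq_mode_add_finsum, sub_add_cancel_left]
  exact neg_mem (finsum_mem_submodule _ _ fun j =>
    zsmul_mem_submodule _ _ (W.mode_mem_below ha hv (by omega)))

/-- If homogeneous vectors with a property span `M`, those of degree `n` span `M(n)`. -/
theorem AdmissibleModule.gr_le_span {S : Set M} (P : ℕ → M → Prop)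
    (hS : ∀ v ∈ S, ∃ n, v ∈ W.gr n ∧ P n v) (hspan : Submodule.span ℂ S = ⊤) (n : ℕ) :
    W.gr n ≤ Submodule.span ℂ {v | v ∈ W.gr n ∧ P n v} := by
  let e := (LinearEquiv.ofBijective (DirectSum.coeLinearMap W.gr) W.isInternal_gr).symm
  have he (m : ℕ) (v : M) (hv : v ∈ W.gr m) :
      e v = DirectSum.lof ℂ ℕ (fun k => W.gr k) m ⟨v, hv⟩ :=
    (LinearEquiv.symm_apply_eq _).mpr (DirectSum.coeLinearMap_lof W.gr m ⟨v, hv⟩).symm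
  let π : M →ₗ[ℂ] M :=
    (W.gr n).subtype ∘ₗ DirectSum.component ℂ ℕ (fun k => W.gr k) n ∘ₗ e.toLinearMap
  -- The projection `π` onto degree `n` fixes the spanning vectors of degree `n` and kills the
  -- others, so it maps all of `M` into the span.
  have key : ⊤ ≤ (Submodule.span ℂ {v | v ∈ W.gr n ∧ P n v}).comap π := by
    rw [← hspan, Submodule.span_le]
    intro v hv
    obtain ⟨m, hm, hP⟩ := hS v hv
    rcases eq_or_ne m n with rfl | hne
    · have : π v = v := by simp [π, he m v hm, DirectSum.component.lof_self]
      rw [SetLike.mem_coe, Submodule.mem_comap, this]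
      exact Submodule.subset_span ⟨hm, hP⟩
    · have : π v = 0 := by simp [π, he m v hm, DirectSum.component.of, hne]
      rw [SetLike.mem_coe, Submodule.mem_comap, this]
      exact zero_mem _
  intro v hv
  have : π v = v := by simp [π, he n v hv, DirectSum.component.lof_self]
  exact this ▸ key (Submodule.mem_top (x := v))

/-! ### The filtration of Zhu's algebra -/

theorem VertexOperatorAlgebra.wt_le_filtration {k n : ℤ} (h0 : 0 ≤ k) (hn : k ≤ n) {a : V}
    (ha : a ∈ A.wt k) : A.adjoint.O.mkQ a ∈ A.filtration n :=
  Submodule.mem_map_of_mem ((le_iSup₂_of_le k ⟨h0, hn⟩ le_rfl : A.wt k ≤ _) ha)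

theorem VertexOperatorAlgebra.filtration_mono {m n : ℤ} (h : m ≤ n) :
    A.filtration m ≤ A.filtration n :=
  Submodule.map_mono (iSup₂_le fun k hk => le_iSup₂_of_le k ⟨hk.1, hk.2.trans h⟩ le_rfl)

theorem VertexOperatorAlgebra.filtration_le_iff (n : ℤ) (S : Submodule ℂ A.ZhuAlgebra) :
    A.filtration n ≤ S ↔ ∀ k, 0 ≤ k → k ≤ n → ∀ a ∈ A.wt k, A.adjoint.O.mkQ a ∈ S := by
  rw [VertexOperatorAlgebra.filtration, Submodule.map_le_iff_le_comap]
  simp only [iSup_le_iff, and_imp]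
  rfl

/-- The modes `a_{-1+j} b` have weight `k + l - j`. Those of negative weight vanish by `hA`, which
is needed because the filtration only involves weights `≥ 0`. For `s = k` this says that the product
is filtered. -/
theorem VertexOperatorAlgebra.mkQ_residue_mem_filtration (hA : ∀ n < 0, A.wt n = ⊥) {k l n : ℤ}
    (h : k + l ≤ n) {a b : V} (ha : a ∈ A.wt k) (hb : b ∈ A.wt l) (s : ℤ) :
    A.adjoint.O.mkQ (residue A.Y s (-1) a b) ∈ A.filtration n := by
  obtain ⟨N, hN⟩ := exists_mode_eq_zero A.Y a b
  rw [residue_eq_sum A.Y s (-1) a b (N + 1).toNat fun m hm => hN m (by omega), map_sum]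
  refine Submodule.sum_mem _ fun j _ => ?_
  rw [map_zsmul]
  refine zsmul_mem_submodule _ _ ?_
  have hmem := A.mode_mem k l (-1 + j) a b ha hb
  rcases lt_or_ge (k + l - (-1 + j) - 1) 0 with h0 | h0
  · rw [hA _ h0, Submodule.mem_bot] at hmem
    rw [hmem, map_zero]
    exact zero_mem _
  · exact wt_le_filtration h0 (by omega) hmem

/-! ### The submodules spanned by the actions on the generators -/

variable {r : ℕ} (d : Fin r → ℕ) (w : Fin r → M)

/-- The sum of the images of `A(V)_{n - dᵢ}` under the maps `a ↦ a * wᵢ`. -/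
noncomputable def AdmissibleModule.leftSpan (n : ℕ) : Submodule ℂ W.ZhuBimodule :=
  ⨆ i, (A.filtration ((n : ℤ) - d i)).map (W.leftAct.flip (W.O.mkQ (w i)))

/-- The sum of the images of `A(V)_{n - dᵢ}` under the maps `a ↦ wᵢ * a`. -/
noncomputable def AdmissibleModule.rightSpan (n : ℕ) : Submodule ℂ W.ZhuBimodule :=
  ⨆ i, (A.filtration ((n : ℤ) - d i)).map (W.rightAct.flip (W.O.mkQ (w i)))

variable {d w}

theorem AdmissibleModule.leftSpan_mono {m n : ℕ} (h : m ≤ n) :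
    W.leftSpan d w m ≤ W.leftSpan d w n :=
  iSup_mono fun _ => Submodule.map_mono (A.filtration_mono (by omega))

theorem AdmissibleModule.rightSpan_mono {m n : ℕ} (h : m ≤ n) :
    W.rightSpan d w m ≤ W.rightSpan d w n :=
  iSup_mono fun _ => Submodule.map_mono (A.filtration_mono (by omega))

theorem AdmissibleModule.leftSpan_le_iff (n : ℕ) (S : Submodule ℂ W.ZhuBimodule) :
    W.leftSpan d w n ≤ S ↔ ∀ i k, 0 ≤ k → k ≤ (n : ℤ) - d i → ∀ a ∈ A.wt k,
      W.leftAct (A.adjoint.O.mkQ a) (W.O.mkQ (w i)) ∈ S := by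
  simp only [AdmissibleModule.leftSpan, iSup_le_iff, Submodule.map_le_iff_le_comap,
    A.filtration_le_iff, Submodule.mem_comap, LinearMap.flip_apply]

theorem AdmissibleModule.rightSpan_le_iff (n : ℕ) (S : Submodule ℂ W.ZhuBimodule) :
    W.rightSpan d w n ≤ S ↔ ∀ i k, 0 ≤ k → k ≤ (n : ℤ) - d i → ∀ a ∈ A.wt k,
      W.rightAct (A.adjoint.O.mkQ a) (W.O.mkQ (w i)) ∈ S := by
  simp only [AdmissibleModule.rightSpan, iSup_le_iff, Submodule.map_le_iff_le_comap,
    A.filtration_le_iff, Submodule.mem_comap, LinearMap.flip_apply]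

theorem AdmissibleModule.leftAct_mem_leftSpan {n : ℕ} {i : Fin r} {x : A.ZhuAlgebra}
    (hx : x ∈ A.filtration ((n : ℤ) - d i)) :
    W.leftAct x (W.O.mkQ (w i)) ∈ W.leftSpan d w n :=
  (le_iSup (fun i => (A.filtration ((n : ℤ) - d i)).map (W.leftAct.flip (W.O.mkQ (w i)))) i)
    (Submodule.mem_map_of_mem (f := W.leftAct.flip (W.O.mkQ (w i))) hx)

theorem AdmissibleModule.rightAct_mem_rightSpan {n : ℕ} {i : Fin r} {x : A.ZhuAlgebra}
    (hx : x ∈ A.filtration ((n : ℤ) - d i)) :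
    W.rightAct x (W.O.mkQ (w i)) ∈ W.rightSpan d w n :=
  (le_iSup (fun i => (A.filtration ((n : ℤ) - d i)).map (W.rightAct.flip (W.O.mkQ (w i)))) i)
    (Submodule.mem_map_of_mem (f := W.rightAct.flip (W.O.mkQ (w i))) hx)

theorem AdmissibleModule.leftSpan_le_filtration (hw : ∀ i, w i ∈ W.gr (d i)) (n : ℕ) :
    W.leftSpan d w n ≤ W.filtration n := by
  refine (W.leftSpan_le_iff n _).mpr fun i k _ hk a ha => ?_
  rw [W.leftAct_mk k ha, W.filtration_eq]
  exact Submodule.mem_map_of_mem (W.residue_mem_below k ha (hw i) (by push_cast; omega))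

theorem AdmissibleModule.rightSpan_le_filtration (hw : ∀ i, w i ∈ W.gr (d i)) (n : ℕ) :
    W.rightSpan d w n ≤ W.filtration n := by
  refine (W.rightSpan_le_iff n _).mpr fun i k _ hk a ha => ?_
  rw [W.rightAct_mk k ha, W.filtration_eq]
  exact Submodule.mem_map_of_mem (W.residue_mem_below _ ha (hw i) (by push_cast; omega))

/-- This is where associativity is used: `a * (b * w_i) = (a * b) * w_i`, and `a * b` has filtration
degree at most `k + l`, where `l` is the weight of `b`. -/
theorem AdmissibleModule.leftAct_mem_leftSpan_of_mem (hA : ∀ n < 0, A.wt n = ⊥) {m n : ℕ} {k : ℤ}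
    (h : m + k ≤ n) {a : V} (ha : a ∈ A.wt k) {x : W.ZhuBimodule} (hx : x ∈ W.leftSpan d w m) :
    W.leftAct (A.adjoint.O.mkQ a) x ∈ W.leftSpan d w n := by
  have : W.leftSpan d w m ≤ (W.leftSpan d w n).comap (W.leftAct (A.adjoint.O.mkQ a)) := by
    refine (W.leftSpan_le_iff m _).mpr fun i l _ hl b hb => ?_
    rw [Submodule.mem_comap, W.leftAct_leftAct ha hb]
    exact W.leftAct_mem_leftSpan (A.mkQ_residue_mem_filtration hA (by omega) ha hb k)
  exact this hx

theorem AdmissibleModule.mkQ_mem_filtration {n : ℕ} {v : M} (hv : v ∈ W.gr n) :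
    W.O.mkQ v ∈ W.filtration n :=
  Submodule.mem_map_of_mem
    ((le_iSup₂_of_le n le_rfl le_rfl : W.gr n ≤ ⨆ (k : ℕ) (_ : k ≤ n), W.gr k) hv)

theorem AdmissibleModule.map_below_le {n : ℕ} {S : Submodule ℂ W.ZhuBimodule}
    (h : ∀ m < n, W.filtration m ≤ S) : (W.below n).map W.O.mkQ ≤ S := by
  rw [Submodule.map_le_iff_le_comap, AdmissibleModule.below]
  exact iSup₂_le fun m hm v hv => h m hm (W.mkQ_mem_filtration hv)

theorem AdmissibleModule.filtration_le {n : ℕ} {S : Submodule ℂ W.ZhuBimodule}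
    (h : ∀ m < n, W.filtration m ≤ S) (hn : ∀ v ∈ W.gr n, W.O.mkQ v ∈ S) :
    W.filtration n ≤ S := by
  rw [AdmissibleModule.filtration, Submodule.map_le_iff_le_comap]
  refine iSup₂_le fun m hm v hv => ?_
  rcases hm.lt_or_eq with hlt | rfl
  · exact h m hlt (W.mkQ_mem_filtration hv)
  · exact hn v hv

/-! ### Reduction of monomials and the two equalities -/

/-- The assertion is conditional on all lower degrees because replacing a mode by a residue leaves
arbitrary vectors of lower degree, not shorter monomials. -/
theorem AdmissibleModule.exists_gr_of_isMonomial (hA : ∀ n < 0, A.wt n = ⊥)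
    (hw : ∀ i, w i ∈ W.gr (d i)) {v : M} (hv : W.IsMonomial (Set.range w) v) :
    ∃ n, v ∈ W.gr n ∧
      ((∀ m < n, W.filtration m ≤ W.leftSpan d w m) → W.O.mkQ v ∈ W.leftSpan d w n) := by
  induction hv with
  | base v hv =>
    obtain ⟨i, rfl⟩ := hv
    refine ⟨d i, hw i, fun _ => ?_⟩
    rw [← W.leftAct_vacuum]
    exact W.leftAct_mem_leftSpan (A.wt_le_filtration le_rfl (by simp) A.vacuum_mem)
  | step k a q v hk ha hq hv ih =>
    -- Only the degree of `v` is kept. Since `k, q ≥ 1`, this degree is below `n = m + k + q - 1`,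
    -- so the hypothesis on lower degrees already covers `v`.
    obtain ⟨m, hm, -⟩ := ih
    obtain ⟨n, hn⟩ : ∃ n : ℕ, (n : ℤ) = m + k - -(q : ℤ) - 1 := ⟨(m + k + q - 1).toNat, by omega⟩
    refine ⟨n, W.mode_mem k _ m n a v ha hm hn, fun ih => ?_⟩
    have hlow := W.map_below_le (fun l hl => (ih l hl).trans (W.leftSpan_mono hl.le))
      (Submodule.mem_map_of_mem (f := W.O.mkQ)
        (W.mode_sub_residue_mem_below k ha hm (p := -(q : ℤ)) hn.ge))
    rw [map_sub] at hlow
    refine (Submodule.sub_mem_iff_left _ ?_).mp hlow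
    obtain ⟨q, rfl⟩ := Nat.exists_eq_add_of_le' hq
    -- After the shift of `q`, the first case is mode `-1`, where the residue is `a * v`. In the
    -- second, the pole has order at least two and the residue is in `O(M)`.
    rcases q with _ | q
    · have := W.leftAct_mem_leftSpan_of_mem hA (n := n) (by push_cast at hn; omega) ha
        (ih m (by push_cast at hn; omega) (W.mkQ_mem_filtration hm))
      rw [W.leftAct_mk k ha] at this
      simpa using this
    · have : residue W.Y k (-((q + 1 + 1 : ℕ) : ℤ)) a v ∈ W.O :=
        residue_mem_O W.toWeakModule 0 q (by omega) k a v ha _ _ (by simp) (by push_cast; ring)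
      rw [Submodule.mkQ_apply, (Submodule.Quotient.mk_eq_zero _).mpr this]
      exact zero_mem _

theorem AdmissibleModule.filtration_eq_leftSpan (hA : ∀ n < 0, A.wt n = ⊥)
    (hw : ∀ i, w i ∈ W.gr (d i)) (hgen : W.StronglyGeneratedBy (Set.range w)) (n : ℕ) :
    W.filtration n = W.leftSpan d w n := by
  refine le_antisymm ?_ (W.leftSpan_le_filtration hw n)
  induction n using Nat.strong_induction_on with
  | _ n ih =>
    refine W.filtration_le (fun m hm => (ih m hm).trans (W.leftSpan_mono hm.le)) fun v hv => ?_
    -- The property transported is the whole implication; its premise is discharged by `ih` once the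
    -- degree is fixed to `n`.
    have h := W.gr_le_span (fun n v => (∀ m < n, W.filtration m ≤ W.leftSpan d w m) →
      W.O.mkQ v ∈ W.leftSpan d w n) (fun v hv => W.exists_gr_of_isMonomial hA hw hv) hgen n hv
    have hle : Submodule.span ℂ {v | v ∈ W.gr n ∧
        ((∀ m < n, W.filtration m ≤ W.leftSpan d w m) → W.O.mkQ v ∈ W.leftSpan d w n)} ≤
          (W.leftSpan d w n).comap W.O.mkQ :=
      Submodule.span_le.mpr fun u hu => hu.2 ih
    exact hle h

theorem AdmissibleModule.filtration_eq_rightSpan (hA : ∀ n < 0, A.wt n = ⊥)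
    (hw : ∀ i, w i ∈ W.gr (d i)) (hgen : W.StronglyGeneratedBy (Set.range w)) (n : ℕ) :
    W.filtration n = W.rightSpan d w n := by
  refine le_antisymm ?_ (W.rightSpan_le_filtration hw n)
  induction n using Nat.strong_induction_on with
  | _ n ih =>
    rw [W.filtration_eq_leftSpan hA hw hgen n]
    refine (W.leftSpan_le_iff n _).mpr fun i k hk hkn a ha => ?_
    -- From `(1+z)^k z^{-1} = (1+z)^{k-1} z^{-1} + (1+z)^{k-1}`: `a * w_i` is `w_i * a` plus a
    -- residue with `z^0`, of degree at most `d i + k - 1 < n`.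
    have h := residue_succ W.Y (k - 1) (-1) a (w i)
    rw [sub_add_cancel, neg_add_cancel] at h
    rw [W.leftAct_mk k ha, h, map_add, ← W.rightAct_mk k ha]
    refine add_mem (W.rightAct_mem_rightSpan (A.wt_le_filtration hk hkn ha)) ?_
    exact W.map_below_le (fun m hm => (ih m hm).trans (W.rightSpan_mono hm.le))
      (Submodule.mem_map_of_mem (W.residue_mem_below _ ha (hw i) (by omega)))

end Filtration

end VOA

theorem proposition4p11
    {V M : Type*} [AddCommGroup V] [Module ℂ V] [AddCommGroup M] [Module ℂ M]
    (A : VOA.VertexOperatorAlgebra V) (hA : A.IsCFTType) (W : VOA.AdmissibleModule A M)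
    (r : ℕ) (d : Fin r → ℕ) (w : Fin r → M) (hw : ∀ i, w i ∈ W.gr (d i))
    (hgen : W.StronglyGeneratedBy (Set.range w)) (n : ℕ) :
    W.filtration n =
        ⨆ i, (A.filtration ((n : ℤ) - d i)).map (W.leftAct.flip (W.O.mkQ (w i))) ∧
      W.filtration n =
        ⨆ i, (A.filtration ((n : ℤ) - d i)).map (W.rightAct.flip (W.O.mkQ (w i))) :=
  ⟨W.filtration_eq_leftSpan hA.1 hw hgen n, W.filtration_eq_rightSpan hA.1 hw hgen n⟩
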